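/- Let $(\mathbb{A},\mathcal{G})$ be a measurable space. For arbitrary (not necessarily $\sigma$-finite or s-finite) measures $\mu,\nu$ on $(\mathbb{A},\mathcal{G})$ the information divergence is \[ D(\mu\Vert\nu)=\sup_{\mathcal{F}}\ \sum_{A\text{ atom of }\mathcal{F}} f\!\left(\frac{\mu(A)}{\nu(A)}\right)\nu(A)\in[0,\infty],\qquad f(x)=x\ln x-(x-1), \] where the supremum is over all finite sub-$\sigma$-algebras $\mathcal{F}\subseteq\mathcal{G}$, with the conventions $f(\infty)=\infty$, $f(\tfrac00)\cdot 0=f(\tfrac\infty\infty)\cdot\infty=0$ and $f(\infty)\cdot 0=\infty$. A point process on $\mathbb{A}$ is a kernel $\omega\mapsto\eta_\omega$ from a probability space $(\Omega,P)$ to $\mathbb{A}$ such that $\eta_\omega(A)\in\{0,1,2,\dots\}\cup\{\infty\}$ for all $\omega$ and all measurable $A$; its expectation measure is $\mu=\int\eta_\omega\,\mathrm{d}P(\omega)$. It is a Poisson point process with expectation measure $\mu$ if for every $A\in\mathcal{G}$ the random variable $\eta(A)$ is Poisson distributed with mean $\mu(A)\in[0,\infty]$ (the Poisson distribution with mean $\infty$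 being the point mass at $\infty$), and if for every finite family of pairwise disjoint sets $A_1,\dots,A_n\in\mathcal{G}$ the random variables $\eta(A_1),\dots,\eta(A_n)$ are independent. Its law, denoted $Po(\mu)$, is a probability measure on the space of measures on $\mathbb{A}$ equipped with the $\sigma$-algebra generated by the evaluations $m\mapsto m(A)$, $A\in\mathcal{G}$. Theorem. Let $\mu$ and $\nu$ be measures on $\mathbb{A}$ that are the expectation measures of Poisson point processes with laws $Po(\mu)$ and $Po(\nu)$ (the two processes may be defined on different probability spaces). If $D(\mu\Vert\nu)<\infty$, then \[ D(\mu\Vert\nu)=D\bigl(Po(\mu)\,\Vert\,Po(\nu)\bigr). \] -/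

import Mathlib

open MeasureTheory ProbabilityTheory
open scoped ENNReal

noncomputable section

namespace ExpectationMeasure

/-! ### Information divergence of arbitrary measures -/

/-- The generator `f x = x * log x - (x - 1)` on `[0, ∞]`, with `f ∞ = ∞`
(`InformationTheory.klFun x = x * log x + 1 - x`, which is nonnegative for `x ≥ 0`). -/
def divFun (x : ℝ≥0∞) : ℝ≥0∞ :=
  if x = ∞ then ∞ else ENNReal.ofReal (InformationTheory.klFun x.toReal)

open Classical in
/-- The summand `f (x / y) * y` for masses `x, y ∈ [0, ∞]`, with the conventions
`f (0 / 0) * 0 = f (∞ / ∞) * ∞ = 0` and `f ∞ * 0 = ∞`. -/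
def divTerm (x y : ℝ≥0∞) : ℝ≥0∞ :=
  if (x = 0 ∧ y = 0) ∨ (x = ∞ ∧ y = ∞) then 0
  else if y = 0 then ∞
  else divFun (x / y) * y

/-- `A` is an atom of the σ-algebra `m`: a minimal nonempty element of `m`. -/
def IsAtomOf {α : Type*} (m : MeasurableSpace α) (A : Set α) : Prop :=
  MeasurableSet[m] A ∧ A.Nonempty ∧ ∀ B ⊆ A, MeasurableSet[m] B → B = ∅ ∨ B = A

/-- The divergence of the restrictions of `μ` and `ν` to a finite sub-σ-algebra `m`, regarded as
discrete measures on the set of atoms of `m`. -/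
def divOn {α : Type*} {mα : MeasurableSpace α} (μ ν : Measure α) (m : MeasurableSpace α) : ℝ≥0∞ :=
  ∑' A : {A : Set α // IsAtomOf m A}, divTerm (μ A.1) (ν A.1)

/-- Information divergence `D(μ‖ν)` of two arbitrary measures: the supremum, over all finite
sub-σ-algebras, of the divergences of the restricted measures. -/
def infoDiv {α : Type*} {mα : MeasurableSpace α} (μ ν : Measure α) : ℝ≥0∞ :=
  ⨆ (m : MeasurableSpace α) (_ : m ≤ mα) (_ : {A : Set α | MeasurableSet[m] A}.Finite), divOn μ ν m

/-! ### Point processes -/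

/-- An empirical measure: each measurable set has mass a natural number or `∞`. -/
def IsEmpirical {α : Type*} [MeasurableSpace α] (m : Measure α) : Prop :=
  ∀ A : Set α, MeasurableSet A → ∃ k : ℕ∞, m A = (k : ℝ≥0∞)

/-- The expectation measure `∫ η_ω dP(ω)` of a kernel `η`. -/
def expectationMeasure {Ω α : Type*} [MeasurableSpace Ω] [MeasurableSpace α]
    (P : Measure Ω) (η : Kernel Ω α) : Measure α :=
  P.bind η

/-- The Poisson distribution on `[0, ∞]` with mean `t ∈ [0, ∞]`. It is the point mass at `∞` if
`t = ∞` (and the point mass at `0` if `t = 0`). -/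
def poissonLaw (t : ℝ≥0∞) : Measure ℝ≥0∞ :=
  if t = ∞ then Measure.dirac ∞
  else (poissonMeasure t.toNNReal).map (fun k : ℕ => (k : ℝ≥0∞))

/-- A Poisson point process on `α`, defined on the probability space `(Ω, P)`: a point process
for which the mass of each measurable set is Poisson distributed, the mean being the mass
that the expectation measure gives to this set, and for which the masses of finitely many
pairwise disjoint measurable sets are independent. -/
structure IsPoissonProcess {Ω α : Type*} [MeasurableSpace Ω] [MeasurableSpace α]
    (P : Measure Ω) (η : Kernel Ω α) : Prop where
  empirical : ∀ ω, IsEmpirical (η ω)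
  poisson : ∀ A : Set α, MeasurableSet A →
    P.map (fun ω => η ω A) = poissonLaw (expectationMeasure P η A)
  indep : ∀ (n : ℕ) (A : Fin n → Set α), (∀ i, MeasurableSet (A i)) →
    Pairwise (fun i j => Disjoint (A i) (A j)) → iIndepFun (fun i ω => η ω (A i)) P

/-- The law of a point process: a measure on the space of measures on `α`, which carries the
σ-algebra generated by the evaluations `m ↦ m A` with `A` measurable. -/
def processLaw {Ω α : Type*} [MeasurableSpace Ω] [MeasurableSpace α]
    (P : Measure Ω) (η : Kernel Ω α) : Measure (Measure α) :=
  P.map η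

end ExpectationMeasure

end

open Set Filter Topology InformationTheory
open scoped NNReal symmDiff

/-! Everything rests on one identity. For a finite measurable partition, the cell masses of a
Poisson process are independent Poisson variables, and the Kullback-Leibler divergence between
Poisson laws of means `s` and `t` is exactly `divTerm s t`. By additivity over products, the
divergence between the two laws of the cell-mass vector equals the divergence of the expectation
measures on that partition (`klDiv_map_cellMass`). Cells of infinite mass are harmless: a finite
`divTerm` forces both means to be infinite together, and both laws are then the point mass at `∞`.

For `≤`, the cell-mass vector takes countably many values, so its divergence is a supremum over
finite partitions (`klDiv_le_infoDiv_of_countable`), and it is an image of the process law. For `≥`,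
the σ-algebras of the cell-mass maps are directed under refinement and generate the σ-algebra on
measures; lower semicontinuity reduces the divergence of the process laws to events depending on one
cell-mass vector (`infoDiv_le_of_directed`), where the identity applies. -/

namespace ExpectationMeasure

/-! ### Finite σ-algebras as finite partitions -/

section Partitions

variable {α β : Type*} [mα : MeasurableSpace α] [MeasurableSpace β]

@[simp]
lemma divTerm_zero_zero : divTerm 0 0 = 0 := by simp [divTerm]

@[simp]
lemma divTerm_top_top : divTerm ∞ ∞ = 0 := by simp [divTerm]

lemma divTerm_zero_right {x : ℝ≥0∞} (hx : x ≠ 0) : divTerm x 0 = ∞ := by simp [divTerm, hx]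

lemma divTerm_top_left {y : ℝ≥0∞} (hy : y ≠ ∞) : divTerm ∞ y = ∞ := by
  by_cases h : y = 0
  · simp [divTerm, h]
  · simp [divTerm, h, hy, divFun, ENNReal.top_div_of_ne_top hy]

lemma divTerm_top_right {x : ℝ≥0∞} (hx : x ≠ ∞) : divTerm x ∞ = ∞ := by
  simp [divTerm, hx, divFun, klFun]

lemma divTerm_coe (x : ℝ≥0) {y : ℝ≥0} (hy : y ≠ 0) :
    divTerm x y = ENNReal.ofReal (y * klFun (x / y)) := by
  have hxy : (x : ℝ≥0∞) / y ≠ ∞ := ENNReal.div_ne_top ENNReal.coe_ne_top (by simpa using hy)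
  rw [divTerm, if_neg (by simp [hy]), if_neg (by simpa using hy), divFun, if_neg hxy,
    ENNReal.toReal_div, mul_comm (y : ℝ), ENNReal.ofReal_mul (klFun_nonneg (by positivity))]
  simp

/-- The divergence between the images under a finitely valued measurable map is at most the
information divergence. -/
lemma sum_divTerm_le_infoDiv {ι : Type*} [Fintype ι] [MeasurableSpace ι]
    [MeasurableSingletonClass ι] (μ ν : Measure α) {X : α → ι} (hX : Measurable X) :
    ∑ i, divTerm (μ (X ⁻¹' {i})) (ν (X ⁻¹' {i})) ≤ infoDiv μ ν := by
  classical
  set m : MeasurableSpace α := MeasurableSpace.comap X inferInstance with hm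
  have hfin : {A : Set α | MeasurableSet[m] A}.Finite := by
    refine (Set.finite_range fun s : Set ι ↦ X ⁻¹' s).subset ?_
    rintro A ⟨s, -, rfl⟩
    exact ⟨s, rfl⟩
  refine le_trans ?_ (le_iSup₂_of_le m hX.comap_le (le_iSup_of_le hfin le_rfl))
  have hatom (i : range X) : IsAtomOf m (X ⁻¹' {i.1}) := by
    obtain ⟨_, x, rfl⟩ := i
    refine ⟨⟨{X x}, measurableSet_singleton _, rfl⟩, ⟨x, rfl⟩, ?_⟩
    rintro _ hB ⟨s, -, rfl⟩
    by_cases hx : X x ∈ s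
    · exact .inr (hB.antisymm fun y hy ↦ by rw [mem_preimage, (show X y = X x from hy)]; exact hx)
    · refine .inl (eq_empty_of_forall_notMem fun y hy ↦ hx ?_)
      rw [← (show X y = X x from hB hy)]
      exact hy
  have hinj : Function.Injective
      fun i : range X ↦ (⟨X ⁻¹' {i.1}, hatom i⟩ : {A : Set α // IsAtomOf m A}) := by
    rintro ⟨_, x, rfl⟩ ⟨_, y, rfl⟩ h
    have h' : x ∈ X ⁻¹' {X y} := (Subtype.ext_iff.1 h).subset rfl
    exact Subtype.ext h'
  calc ∑ i, divTerm (μ (X ⁻¹' {i})) (ν (X ⁻¹' {i}))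
  _ = ∑' i, divTerm (μ (X ⁻¹' {i})) (ν (X ⁻¹' {i})) := (tsum_fintype _).symm
  -- Only nonempty fibres are atoms; empty ones contribute `divTerm 0 0 = 0`.
  _ = ∑' i : range X, divTerm (μ (X ⁻¹' {i.1})) (ν (X ⁻¹' {i.1})) := by
    refine (tsum_subtype_eq_of_support_subset fun i hi ↦ ?_).symm
    by_contra hi'
    refine hi ?_
    simp [preimage_singleton_eq_empty.2 hi']
  _ ≤ divOn μ ν m := ENNReal.tsum_comp_le_tsum_of_injective hinj
      (fun A ↦ divTerm (μ A.1) (ν A.1))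

/-- Label each point by the collection of sets of the finite σ-algebra that contain it. By
minimality, the fibre through a point of an atom is that atom; any other labels only add nonnegative
terms. -/
lemma infoDiv_le {μ ν : Measure α} {c : ℝ≥0∞}
    (h : ∀ (k : ℕ) (X : α → Fin k), Measurable X →
      ∑ i, divTerm (μ (X ⁻¹' {i})) (ν (X ⁻¹' {i})) ≤ c) : infoDiv μ ν ≤ c := by
  classical
  refine iSup₂_le fun m hm ↦ iSup_le fun hfin ↦ ?_
  have : Finite {A : Set α // MeasurableSet[m] A} := hfin
  obtain ⟨k, ⟨e⟩⟩ := Finite.exists_equiv_fin (Set {A : Set α // MeasurableSet[m] A})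
  let Y : α → Set {A : Set α // MeasurableSet[m] A} := fun x ↦ {B | x ∈ B.1}
  have hY : Measurable[m] Y := measurable_set_iff.2 fun B ↦ measurable_mem.2 B.2
  have heY : Measurable[mα] (e ∘ Y) := (measurable_of_countable e).comp (hY.mono hm le_rfl)
  have hpre (A : {A : Set α // IsAtomOf m A}) {x : α} (hx : x ∈ A.1) :
      (e ∘ Y) ⁻¹' {e (Y x)} = A.1 := by
    ext y
    simp only [mem_preimage, Function.comp_apply, mem_singleton_iff, e.apply_eq_iff_eq]
    refine ⟨fun hy ↦ ?_, fun hy ↦ ?_⟩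
    · have : (⟨A.1, A.2.1⟩ : {A : Set α // MeasurableSet[m] A}) ∈ Y x := hx
      rw [← hy] at this
      exact this
    · have key {u v : α} (hu : u ∈ A.1) (hv : v ∈ A.1) (B : {A : Set α // MeasurableSet[m] A})
          (hB : u ∈ B.1) : v ∈ B.1 := by
        rcases A.2.2.2 (A.1 ∩ B.1) inter_subset_left (A.2.1.inter B.2) with h0 | h0
        · exact absurd (show u ∈ A.1 ∩ B.1 from ⟨hu, hB⟩) (by simp [h0])
        · exact (h0.symm ▸ hv : v ∈ A.1 ∩ B.1).2
      ext B
      exact ⟨key hy hx B, key hx hy B⟩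
  choose x hx using fun A : {A : Set α // IsAtomOf m A} ↦ A.2.2.1
  have hinj : Function.Injective fun A ↦ e (Y (x A)) := fun A B hAB ↦ by
    refine Subtype.ext ?_
    rw [← hpre A (hx A), ← hpre B (hx B)]
    exact congrArg (fun i ↦ (e ∘ Y) ⁻¹' {i}) hAB
  calc divOn μ ν m
  _ = ∑' A, divTerm (μ ((e ∘ Y) ⁻¹' {e (Y (x A))})) (ν ((e ∘ Y) ⁻¹' {e (Y (x A))})) :=
    tsum_congr fun A ↦ by rw [hpre A (hx A)]
  _ ≤ ∑' i, divTerm (μ ((e ∘ Y) ⁻¹' {i})) (ν ((e ∘ Y) ⁻¹' {i})) :=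
    ENNReal.tsum_comp_le_tsum_of_injective hinj
      (fun i ↦ divTerm (μ ((e ∘ Y) ⁻¹' {i})) (ν ((e ∘ Y) ⁻¹' {i})))
  _ ≤ c := by
    rw [tsum_fintype]
    exact h k _ heY

lemma infoDiv_map_le (μ ν : Measure α) {f : α → β} (hf : Measurable f) :
    infoDiv (μ.map f) (ν.map f) ≤ infoDiv μ ν := by
  refine infoDiv_le fun k X hX ↦ ?_
  refine le_trans (le_of_eq ?_) (sum_divTerm_le_infoDiv μ ν (hX.comp hf))
  refine Finset.sum_congr rfl fun i _ ↦ ?_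
  rw [Measure.map_apply hf (hX (measurableSet_singleton i)),
    Measure.map_apply hf (hX (measurableSet_singleton i)), preimage_comp]

end Partitions

/-! ### Finite measures: comparison with the Kullback-Leibler divergence -/

section FiniteMeasures

variable {α : Type*} [MeasurableSpace α] (μ ν : Measure α) [IsFiniteMeasure μ] [IsFiniteMeasure ν]

lemma divTerm_univ_le_klDiv : divTerm (μ univ) (ν univ) ≤ klDiv μ ν := by
  by_cases hac : μ ≪ ν
  swap
  · simp [hac]
  by_cases hint : Integrable (llr μ ν) μ
  swap
  · simp [klDiv_of_not_integrable hint]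
  by_cases hν : ν univ = 0
  · simp [hν, hac hν]
  have h := ENNReal.ofReal_le_ofReal (mul_klFun_le_toReal_klDiv hac hint)
  rw [ENNReal.ofReal_toReal (klDiv_ne_top hac hint)] at h
  refine le_trans (le_of_eq ?_) h
  rw [← ENNReal.coe_toNNReal (measure_ne_top μ univ), ← ENNReal.coe_toNNReal (measure_ne_top ν univ),
    divTerm_coe]
  · rfl
  · simpa [ENNReal.toNNReal_eq_zero_iff] using hν

/-- The divergence is the integral of a nonnegative function of the density, so it splits over
disjoint sets; on each one the single-cell bound `divTerm_univ_le_klDiv` applies. The sets need not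
cover the space. -/
lemma sum_divTerm_le_klDiv {ι : Type*} [Fintype ι] {A : ι → Set α}
    (hA : ∀ i, MeasurableSet (A i)) (hd : Pairwise fun i j ↦ Disjoint (A i) (A j)) :
    ∑ i, divTerm (μ (A i)) (ν (A i)) ≤ klDiv μ ν := by
  by_cases hac : μ ≪ ν
  swap
  · simp [hac]
  rw [klDiv_eq_lintegral_klFun_of_ac hac]
  calc ∑ i, divTerm (μ (A i)) (ν (A i))
  _ ≤ ∑ i, ∫⁻ x in A i, ENNReal.ofReal (klFun (μ.rnDeriv ν x).toReal) ∂ν := by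
    refine Finset.sum_le_sum fun i _ ↦ ?_
    have h := divTerm_univ_le_klDiv (μ.restrict (A i)) (ν.restrict (A i))
    rw [Measure.restrict_apply_univ, Measure.restrict_apply_univ,
      klDiv_eq_lintegral_klFun_of_ac (hac.restrict _)] at h
    refine h.trans (le_of_eq (lintegral_congr_ae ?_))
    have h1 : (μ.restrict (A i)).rnDeriv (ν.restrict (A i)) =ᵐ[ν.restrict (A i)]
        μ.rnDeriv ν := by
      refine (Measure.eq_rnDeriv (s := 0) (Measure.measurable_rnDeriv μ ν)
        Measure.MutuallySingular.zero_left ?_).symm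
      rw [zero_add, ← restrict_withDensity (hA i), Measure.withDensity_rnDeriv_eq _ _ hac]
    filter_upwards [h1] with x hx
    rw [hx]
  _ = ∫⁻ x in ⋃ i, A i, ENNReal.ofReal (klFun (μ.rnDeriv ν x).toReal) ∂ν := by
    rw [lintegral_iUnion hA hd, tsum_fintype]
  _ ≤ _ := setLIntegral_le_lintegral _ _

/-- The divergence is a sum over points. Each finite partial sum is bounded using the partition into
those points and one remainder cell, labelled `none`. -/
lemma klDiv_le_infoDiv_of_countable [MeasurableSingletonClass α] {S : Set α} (hS : S.Countable)
    (hνS : ν Sᶜ = 0) (hac : μ ≪ ν) : klDiv μ ν ≤ infoDiv μ ν := by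
  classical
  have hterm (p : α) : ENNReal.ofReal (klFun (μ.rnDeriv ν p).toReal) * ν {p}
      = divTerm (μ {p}) (ν {p}) := by
    by_cases hp : ν {p} = 0
    · simp [hp, hac hp]
    have h1 : μ {p} = μ.rnDeriv ν p * ν {p} := by
      conv_lhs => rw [← Measure.withDensity_rnDeriv_eq _ _ hac]
      rw [withDensity_apply _ (measurableSet_singleton p), lintegral_singleton]
    have h2 : μ.rnDeriv ν p = μ {p} / ν {p} := by
      rw [h1, ENNReal.mul_div_cancel_right hp (measure_ne_top _ _)]
    have h3 : μ {p} / ν {p} ≠ ∞ := ENNReal.div_ne_top (measure_ne_top _ _) hp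
    rw [h2, divTerm, if_neg (by simp [hp]), if_neg hp, divFun, if_neg h3]
  have hsum : klDiv μ ν = ∑' p : S, divTerm (μ {p.1}) (ν {p.1}) := by
    rw [klDiv_eq_lintegral_klFun_of_ac hac]
    conv_lhs => rw [← Measure.restrict_eq_self_of_ae_mem (μ := ν) (s := S) hνS]
    rw [lintegral_countable _ hS]
    refine tsum_congr fun p ↦ ?_
    rw [← hterm, Measure.restrict_eq_self_of_ae_mem (μ := ν) (s := S) hνS]
  rw [hsum, ENNReal.tsum_eq_iSup_sum]
  refine iSup_le fun F ↦ ?_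
  let X : α → Option F := fun x ↦ if h : ∃ p : F, p.1.1 = x then some h.choose else none
  have hX (p : F) : X ⁻¹' {some p} = {p.1.1} := by
    ext x
    simp only [X, mem_preimage, mem_singleton_iff]
    split_ifs with h
    · rw [Option.some_inj]
      refine ⟨fun hp ↦ hp ▸ h.choose_spec.symm, fun hx ↦ ?_⟩
      exact Subtype.ext (Subtype.ext (h.choose_spec.trans hx))
    · simpa using fun hx ↦ h ⟨p, hx.symm⟩
  let _ : MeasurableSpace (Option F) := ⊤
  have hsome (p : F) : MeasurableSet (X ⁻¹' {some p}) := by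
    rw [hX]
    exact measurableSet_singleton _
  have hXm : Measurable X := by
    refine measurable_to_countable' fun o ↦ ?_
    cases o with
    | some p => exact hsome p
    | none =>
      have : X ⁻¹' {none} = (⋃ p, X ⁻¹' {some p})ᶜ := by
        ext x
        cases hx : X x <;> simp [hx]
      rw [this]
      exact (MeasurableSet.iUnion hsome).compl
  refine le_trans ?_ (sum_divTerm_le_infoDiv μ ν hXm)
  rw [Fintype.sum_option, ← Finset.sum_coe_sort F]
  simp only [hX]
  exact le_add_self

end FiniteMeasures

/-! ### Lower semicontinuity of the divergence terms -/

section LowerSemicontinuity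

/-- Legendre duality: for positive masses the maximiser is `c = log (x / y)`. If just one mass
vanishes, the supremum is approached as `c → -∞` (for `x = 0`) or `c → ∞` (for `y = 0`). A supremum
of continuous functions is lower semicontinuous. -/
lemma divTerm_coe_eq_iSup (x y : ℝ≥0) :
    divTerm x y = ⨆ c : ℝ, ENNReal.ofReal (c * x - (Real.exp c - 1) * y) := by
  refine le_antisymm ?_ (iSup_le fun c ↦ ?_)
  · rcases eq_or_ne y 0 with rfl | hy
    · rcases eq_or_ne x 0 with rfl | hx
      · simp
      have hx' : (0 : ℝ) < x := by positivity
      have h : Tendsto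
          (fun c : ℝ ↦ ENNReal.ofReal (c * x - (Real.exp c - 1) * ((0 : ℝ≥0) : ℝ))) atTop (𝓝 ∞) := by
        refine ENNReal.tendsto_ofReal_atTop.comp ?_
        simpa using tendsto_id.atTop_mul_const hx'
      exact le_top.trans (le_of_tendsto' h fun c ↦ le_iSup_of_le c le_rfl)
    · have hy' : (0 : ℝ) < y := by positivity
      rw [divTerm_coe _ hy]
      rcases eq_or_ne x 0 with rfl | hx
      · have h : Tendsto
            (fun c : ℝ ↦ ENNReal.ofReal (c * ((0 : ℝ≥0) : ℝ) - (Real.exp c - 1) * y)) atBot (𝓝 (ENNReal.ofReal (y * klFun ((0 : ℝ≥0) / y)))) := by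
          refine ENNReal.tendsto_ofReal ?_
          have := ((Real.tendsto_exp_atBot.sub_const 1).mul_const (y : ℝ)).neg
          simpa [klFun_apply] using this
        exact le_of_tendsto' h fun c ↦ le_iSup_of_le c le_rfl
      · have hx' : (0 : ℝ) < x := by positivity
        refine le_iSup_of_le (Real.log (x / y)) (ENNReal.ofReal_le_ofReal (le_of_eq ?_))
        rw [klFun_apply, Real.exp_log (by positivity)]
        field_simp
        ring
  · rcases eq_or_ne y 0 with rfl | hy
    · rcases eq_or_ne x 0 with rfl | hx
      · simp
      · rw [ENNReal.coe_zero, divTerm_zero_right (by simpa using hx)]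
        exact le_top
    · have hy' : (0 : ℝ) < y := by positivity
      rw [divTerm_coe _ hy]
      refine ENNReal.ofReal_le_ofReal ?_
      obtain ⟨u, hu0, hxu⟩ : ∃ u : ℝ, 0 ≤ u ∧ (x : ℝ) = u * y :=
        ⟨x / y, by positivity, by field_simp⟩
      have hdiv : (x : ℝ) / y = u := by rw [hxu]; field_simp
      -- For `u > 0` this is `z + 1 ≤ exp z` at `z = c - log u`, multiplied by `u`.
      have key : c * u - (Real.exp c - 1) ≤ klFun u := by
        rw [klFun_apply]
        rcases hu0.eq_or_lt with rfl | hu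
        · simpa using (Real.exp_pos c).le
        · have h1 := mul_le_mul_of_nonneg_left (Real.add_one_le_exp (c - Real.log u)) hu0
          rw [Real.exp_sub, Real.exp_log hu, mul_div_cancel₀ _ hu.ne'] at h1
          linarith
      rw [hdiv, hxu]
      nlinarith

lemma lowerSemicontinuous_divTerm_coe :
    LowerSemicontinuous fun p : ℝ≥0 × ℝ≥0 ↦ divTerm p.1 p.2 := by
  simp only [divTerm_coe_eq_iSup]
  refine lowerSemicontinuous_iSup fun c ↦ Continuous.lowerSemicontinuous ?_
  exact ENNReal.continuous_ofReal.comp (by fun_prop)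

lemma isClosed_sum_divTerm_le {ι : Type*} [Fintype ι] (c : ℝ≥0∞) :
    IsClosed {v : ι → ℝ≥0 × ℝ≥0 | ∑ i, divTerm (v i).1 (v i).2 ≤ c} := by
  have h : LowerSemicontinuous fun v : ι → ℝ≥0 × ℝ≥0 ↦ ∑ i, divTerm (v i).1 (v i).2 :=
    lowerSemicontinuous_sum fun i _ ↦
      lowerSemicontinuous_divTerm_coe.comp (continuous_apply i)
  exact h.isClosed_preimage c

end LowerSemicontinuity

/-! ### Approximation along a directed family of σ-algebras -/

section Approximation

lemma abs_toNNReal_sub_le {β : Type*} [MeasurableSpace β] (P : Measure β) [IsFiniteMeasure P]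
    {s t : Set β} (hs : MeasurableSet s) (ht : MeasurableSet t) :
    |((P s).toNNReal : ℝ) - (P t).toNNReal| ≤ P.real (s ∆ t) :=
  abs_measureReal_sub_le_measureReal_symmDiff hs.nullMeasurableSet ht.nullMeasurableSet

/-- The divergence of finite measures on a σ-algebra generated by a directed family is determined
by the disjoint families that are measurable for one of its members. -/
lemma infoDiv_le_of_directed {β I : Type*} [mβ : MeasurableSpace β] [Nonempty I]
    (σ : I → MeasurableSpace β) (hdir : Directed (· ≤ ·) σ) (hσ : ⨆ i, σ i = mβ)
    (P Q : Measure β) [IsFiniteMeasure P] [IsFiniteMeasure Q] {c : ℝ≥0∞}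
    (h : ∀ i (k : ℕ) (E : Fin k → Set β), (∀ j, MeasurableSet[σ i] (E j)) →
      (Pairwise fun j l ↦ Disjoint (E j) (E l)) → ∑ j, divTerm (P (E j)) (Q (E j)) ≤ c) :
    infoDiv P Q ≤ c := by
  classical
  have hle i : σ i ≤ mβ := hσ ▸ le_iSup σ i
  set C : Set (Set β) := {B | ∃ i, MeasurableSet[σ i] B} with hC
  have hring : IsSetRing C := by
    refine ⟨⟨Classical.arbitrary I, @MeasurableSet.empty _ (σ _)⟩, ?_, ?_⟩
    · rintro s t ⟨i, hs⟩ ⟨j, ht⟩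
      obtain ⟨l, hil, hjl⟩ := hdir i j
      exact ⟨l, (hil _ hs).union (hjl _ ht)⟩
    · rintro s t ⟨i, hs⟩ ⟨j, ht⟩
      obtain ⟨l, hil, hjl⟩ := hdir i j
      exact ⟨l, (hil _ hs).diff (hjl _ ht)⟩
  have huniv : univ ∈ C := ⟨Classical.arbitrary I, @MeasurableSet.univ _ (σ _)⟩
  have hgen : mβ = MeasurableSpace.generateFrom C := by
    refine le_antisymm ?_ (MeasurableSpace.generateFrom_le ?_)
    · rw [← hσ]
      exact iSup_le fun i s hs ↦ MeasurableSpace.measurableSet_generateFrom ⟨i, hs⟩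
    · rintro s ⟨i, hs⟩
      exact hle i s hs
  refine infoDiv_le fun k X hX ↦ ?_
  set A : Fin k → Set β := fun j ↦ X ⁻¹' {j} with hAdef
  have hA j : MeasurableSet (A j) := hX (measurableSet_singleton j)
  have hAd {j l} (hjl : j ≠ l) : Disjoint (A j) (A l) :=
    Disjoint.preimage X (by simpa using hjl)
  let v : Fin k → ℝ≥0 × ℝ≥0 := fun j ↦ ((P (A j)).toNNReal, (Q (A j)).toNNReal)
  -- The sublevel set is closed, so it suffices to approximate the mass vector `v` by mass vectors
  -- of disjoint families to which `h` applies.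
  have hv : v ∈ {v : Fin k → ℝ≥0 × ℝ≥0 | ∑ i, divTerm (v i).1 (v i).2 ≤ c} := by
    rw [← (isClosed_sum_divTerm_le c).closure_eq, Metric.mem_closure_iff]
    intro ε hε
    -- Dividing by `k + 1` keeps the sum of `k` errors strictly below `ε` and also covers `k = 0`.
    have hδ : 0 < ε / (k + 1) := by positivity
    have happ j : ∃ B ∈ C, (P + Q) (B ∆ A j) < ENNReal.ofReal (ε / (k + 1)) :=
      exists_measure_symmDiff_lt_of_generateFrom_isSetRing hring
        ⟨{univ}, countable_singleton _, by simpa using huniv, by simp⟩ hgen (hA j) (by simpa using hδ)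
    choose B hBC hB using happ
    choose i hi using hBC
    obtain ⟨z, hz⟩ := hdir.finset_le (Finset.univ.image i)
    have hBz j : MeasurableSet[σ z] (B j) := hz (i j) (by simp) _ (hi j)
    -- The approximants `B j` may overlap. Since the `A j` are disjoint, disjointification creates
    -- no error outside the union of the `B l ∆ A l`.
    set E : Fin k → Set β := disjointed B with hE
    have hEz j : MeasurableSet[σ z] (E j) := by
      refine disjointedRec (fun s l hs ↦ hs.diff (hBz l)) (hBz j)
    have hEd : Pairwise fun j l ↦ Disjoint (E j) (E l) := disjoint_disjointed B
    have hEA j : E j ∆ A j ⊆ ⋃ l, B l ∆ A l := by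
      intro x hx
      by_contra hx'
      have hx'' l : x ∈ B l ↔ x ∈ A l := by
        simp only [mem_iUnion, not_exists, mem_symmDiff] at hx'
        have := hx' l
        tauto
      have hEj : x ∈ E j ↔ x ∈ A j := by
        rw [hE, disjointed_apply, Set.mem_sdiff, Finset.sup_set_eq_biUnion, hx'']
        refine ⟨fun h ↦ h.1, fun h ↦ ⟨h, ?_⟩⟩
        simp only [mem_iUnion, hx'', not_exists]
        exact fun l hl hxl ↦ disjoint_left.1 (hAd (Finset.mem_Iio.1 hl).ne) hxl h
      rw [mem_symmDiff] at hx
      tauto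
    have hsmall j : (P + Q).real (E j ∆ A j) < ε := by
      calc (P + Q).real (E j ∆ A j) ≤ (P + Q).real (⋃ l, B l ∆ A l) := measureReal_mono (hEA j)
      _ ≤ ∑ l, (P + Q).real (B l ∆ A l) := measureReal_iUnion_fintype_le _
      _ ≤ ∑ _l : Fin k, ε / (k + 1) := by
        refine Finset.sum_le_sum fun l _ ↦ ?_
        exact ENNReal.toReal_le_of_le_ofReal hδ.le (hB l).le
      _ < ε := by
        rw [Finset.sum_const, Finset.card_univ, Fintype.card_fin, nsmul_eq_mul, mul_div_assoc',
          div_lt_iff₀ (by positivity)]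
        nlinarith
    refine ⟨fun j ↦ ((P (E j)).toNNReal, (Q (E j)).toNNReal), ?_, ?_⟩
    · simp only [mem_ofPred_eq, ENNReal.coe_toNNReal (measure_ne_top _ _)]
      exact h z k E hEz hEd
    · rw [dist_pi_lt_iff hε]
      intro j
      have hEm : MeasurableSet (E j) := hle z _ (hEz j)
      have hadd : (P + Q).real (E j ∆ A j) = P.real (E j ∆ A j) + Q.real (E j ∆ A j) :=
        measureReal_add_apply
      have h1 := abs_toNNReal_sub_le P hEm (hA j)
      have h2 := abs_toNNReal_sub_le Q hEm (hA j)
      have h3 := hsmall j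
      have h4 : 0 ≤ P.real (E j ∆ A j) := measureReal_nonneg
      have h5 : 0 ≤ Q.real (E j ∆ A j) := measureReal_nonneg
      rw [dist_comm, Prod.dist_eq, NNReal.dist_eq, NNReal.dist_eq]
      exact max_lt (by linarith) (by linarith)
  simpa only [v, mem_ofPred_eq, ENNReal.coe_toNNReal (measure_ne_top _ _)] using hv

end Approximation

/-! ### Additivity of the divergence over products -/

section Products

variable {α β : Type*} [MeasurableSpace α] [MeasurableSpace β]

/-- Data processing applied to `f`, then to `g`. -/
lemma klDiv_map_of_leftInverse (μ ν : Measure α) [IsFiniteMeasure μ] [IsFiniteMeasure ν]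
    {f : α → β} {g : β → α} (hf : Measurable f) (hg : Measurable g)
    (hgf : Function.LeftInverse g f) : klDiv (μ.map f) (ν.map f) = klDiv μ ν := by
  refine le_antisymm (klDiv_map_le μ ν hf) ?_
  have h := klDiv_map_le (μ.map f) (ν.map f) hg
  rwa [Measure.map_map hg hf, Measure.map_map hg hf, hgf.comp_eq_id, Measure.map_id,
    Measure.map_id] at h

/-- Chain rule for constant kernels. In the conditional term both first marginals are `μ`; swapping
the factors turns `μ` into a common kernel, which drops out. -/
lemma klDiv_prod (μ ν : Measure α) (μ' ν' : Measure β) [IsProbabilityMeasure μ]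
    [IsProbabilityMeasure ν] [IsProbabilityMeasure μ'] [IsProbabilityMeasure ν'] :
    klDiv (μ.prod μ') (ν.prod ν') = klDiv μ ν + klDiv μ' ν' := by
  rw [← Measure.compProd_const, ← Measure.compProd_const, klDiv_compProd_eq_add,
    Measure.compProd_const, Measure.compProd_const]
  congr 1
  rw [← klDiv_map_of_leftInverse (μ.prod μ') (μ.prod ν') measurable_swap measurable_swap
    Prod.swap_leftInverse, Measure.prod_swap, Measure.prod_swap, ← Measure.compProd_const,
    ← Measure.compProd_const, klDiv_compProd_left]

lemma klDiv_pi {k : ℕ} (μ ν : Fin k → Measure α) [∀ i, IsProbabilityMeasure (μ i)]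
    [∀ i, IsProbabilityMeasure (ν i)] :
    klDiv (Measure.pi μ) (Measure.pi ν) = ∑ i, klDiv (μ i) (ν i) := by
  induction k with
  | zero =>
    rw [Measure.pi_of_empty μ, Measure.pi_of_empty ν, klDiv_self]
    simp
  | succ k ih =>
    let e := MeasurableEquiv.piFinSuccAbove (fun _ : Fin (k + 1) ↦ α) 0
    rw [← klDiv_map_of_leftInverse _ _ e.measurable e.symm.measurable e.left_inv,
      (measurePreserving_piFinSuccAbove μ 0).map_eq, (measurePreserving_piFinSuccAbove ν 0).map_eq,
      klDiv_prod, ih, Fin.sum_univ_succ]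
    simp

end Products

/-! ### Divergence between Poisson distributions -/

section Poisson

lemma integral_id_poissonMeasure (s : ℝ≥0) :
    Integrable (fun n : ℕ ↦ (n : ℝ)) (poissonMeasure s) ∧
      ∫ n, (n : ℝ) ∂(poissonMeasure s) = s := by
  have h : HasSum (fun n : ℕ ↦ Real.exp (-s) * s ^ n / n.factorial * (n : ℝ)) s := by
    -- The Poisson weights `p` satisfy `s * p n = (n + 1) * p (n + 1)`.
    have h1 (n : ℕ) : (s : ℝ) * (Real.exp (-s) * s ^ n / n.factorial) =
        Real.exp (-s) * s ^ (n + 1) / (n + 1).factorial * ((n + 1 : ℕ) : ℝ) := by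
      rw [Nat.factorial_succ]
      push_cast
      field_simp
      ring
    rw [← hasSum_nat_add_iff' 1]
    simpa [h1] using (hasSum_one_poissonMeasure s).mul_left (s : ℝ)
  refine ⟨?_, ?_⟩
  · rw [integrable_poissonMeasure_iff]
    simpa using h.summable
  · rw [integral_poissonMeasure]
    simpa using h.tsum_eq

lemma poissonMeasure_eq_withDensity (s : ℝ≥0) {t : ℝ≥0} (ht : t ≠ 0) :
    poissonMeasure s = (poissonMeasure t).withDensity
      fun n ↦ ENNReal.ofReal (Real.exp (t - s) * (s / t) ^ n) := by
  have ht' : (0 : ℝ) < t := by positivity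
  refine Measure.ext_of_singleton fun n ↦ ?_
  rw [withDensity_apply _ (measurableSet_singleton n), lintegral_singleton,
    poissonMeasure_singleton, poissonMeasure_singleton, ← ENNReal.ofReal_mul (by positivity)]
  congr 1
  rw [Real.exp_sub, Real.exp_neg, Real.exp_neg, div_pow]
  field_simp

/-- The log-density is affine in `n`, so its integral needs only the mean `s`. -/
lemma klDiv_poissonMeasure (s : ℝ≥0) {t : ℝ≥0} (ht : t ≠ 0) :
    klDiv (poissonMeasure s) (poissonMeasure t) = divTerm s t := by
  have ht' : (0 : ℝ) < t := by positivity
  set f : ℕ → ℝ≥0∞ := fun n ↦ ENNReal.ofReal (Real.exp (t - s) * (s / t) ^ n) with hf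
  have hd : poissonMeasure s = (poissonMeasure t).withDensity f := poissonMeasure_eq_withDensity s ht
  have hac : poissonMeasure s ≪ poissonMeasure t := hd ▸ withDensity_absolutelyContinuous _ _
  have hrn : (poissonMeasure s).rnDeriv (poissonMeasure t) =ᵐ[poissonMeasure s] f := by
    refine hac.ae_le ?_
    rw [hd]
    exact Measure.rnDeriv_withDensity _ (measurable_of_countable f)
  -- For `s = 0` the density vanishes at `n > 0`, where its logarithm has the default value `0` and
  -- the affine formula fails; these points are null.
  have hsupp : ∀ᵐ n ∂(poissonMeasure s), s = 0 → n = 0 := by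
    rw [ae_iff_of_countable]
    intro n hn hs
    by_contra h0
    refine hn ?_
    simp [poissonMeasure_singleton, hs, h0]
  have hllr : llr (poissonMeasure s) (poissonMeasure t) =ᵐ[poissonMeasure s]
      fun n ↦ (t - s : ℝ) + n * Real.log (s / t) := by
    filter_upwards [hrn, hsupp] with n hn h0
    rw [llr, hn, hf, ENNReal.toReal_ofReal (by positivity), Real.log_mul (by positivity),
      Real.log_exp, Real.log_pow]
    by_cases hs : s = 0
    · simp [h0 hs]
    · positivity
  obtain ⟨hint, hmean⟩ := integral_id_poissonMeasure s
  have hint' : Integrable (fun n : ℕ ↦ (t - s : ℝ) + n * Real.log (s / t)) (poissonMeasure s) :=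
    (integrable_const _).add (hint.mul_const _)
  rw [klDiv_of_ac_of_integrable hac ((integrable_congr hllr).2 hint'), integral_congr_ae hllr,
    integral_add (integrable_const _) (hint.mul_const _), integral_mul_const, hmean, divTerm_coe _ ht]
  congr 1
  simp [klFun_apply]
  field_simp
  ring

instance isProbabilityMeasure_poissonLaw (t : ℝ≥0∞) : IsProbabilityMeasure (poissonLaw t) := by
  unfold poissonLaw
  split_ifs
  · infer_instance
  · exact Measure.isProbabilityMeasure_map (by fun_prop)

lemma klDiv_poissonLaw {s t : ℝ≥0∞} (h : divTerm s t ≠ ∞) :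
    klDiv (poissonLaw s) (poissonLaw t) = divTerm s t := by
  have hst : s = ∞ ↔ t = ∞ := by
    refine ⟨fun hs ↦ ?_, fun ht ↦ ?_⟩
    · by_contra ht
      exact h (hs ▸ divTerm_top_left ht)
    · by_contra hs
      exact h (ht ▸ divTerm_top_right hs)
  by_cases ht : t = ∞
  · rw [hst.2 ht, ht, klDiv_self, divTerm_top_top]
  lift t to ℝ≥0 using ht
  lift s to ℝ≥0 using fun hs ↦ by simp [hst] at hs
  rcases eq_or_ne t 0 with rfl | ht
  · have hs : s = 0 := by
      by_contra hs
      exact h (divTerm_zero_right (by simpa using hs))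
    rw [hs, klDiv_self]
    simp
  have hleft : Function.LeftInverse (fun x : ℝ≥0∞ ↦ ⌊x.toReal⌋₊) (fun k : ℕ ↦ (k : ℝ≥0∞)) :=
    fun k ↦ by simp
  simp only [poissonLaw, ENNReal.coe_ne_top, if_false, ENNReal.toNNReal_coe]
  rw [klDiv_map_of_leftInverse _ _ (measurable_of_countable _)
    (Nat.measurable_floor.comp ENNReal.measurable_toReal) hleft, klDiv_poissonMeasure s ht]

end Poisson

/-! ### Cell masses of Poisson processes -/

section CellMasses

variable {α Ω : Type*} [MeasurableSpace α] [MeasurableSpace Ω]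

/-- The masses that a measure gives to the cells of a finitely valued map. -/
def cellMass {ι : Type*} (X : α → ι) (m : Measure α) (i : ι) : ℝ≥0∞ := m (X ⁻¹' {i})

lemma measurable_cellMass {ι : Type*} [MeasurableSpace ι] [MeasurableSingletonClass ι] {X : α → ι}
    (hX : Measurable X) : Measurable (cellMass X) :=
  measurable_pi_lambda _ fun i ↦ Measure.measurable_coe (hX (measurableSet_singleton i))

/-- The mass of a coarse cell is the sum of the masses of the fine cells in it. -/
lemma comap_cellMass_comp_le {k l : ℕ} {Y : α → Fin l} (hY : Measurable Y) (f : Fin l → Fin k) :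
    MeasurableSpace.comap (cellMass (f ∘ Y)) inferInstance ≤
      MeasurableSpace.comap (cellMass Y) inferInstance := by
  let g : (Fin l → ℝ≥0∞) → Fin k → ℝ≥0∞ := fun v i ↦ ∑ j with f j = i, v j
  have hg : Measurable g := by fun_prop
  have hfac : cellMass (f ∘ Y) = g ∘ cellMass Y := by
    ext m i
    simp only [cellMass, Function.comp_apply, g]
    rw [sum_measure_preimage_singleton _ fun j _ ↦ hY (measurableSet_singleton j)]
    congr 1
    ext x
    simp
  rw [hfac, ← MeasurableSpace.comap_comp]
  exact MeasurableSpace.comap_mono hg.comap_le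

lemma directed_comap_cellMass :
    Directed (· ≤ ·) fun p : Σ k, {X : α → Fin k // Measurable X} ↦
      MeasurableSpace.comap (cellMass p.2.1) inferInstance := by
  rintro ⟨k, X, hX⟩ ⟨l, Y, hY⟩
  let Z : α → Fin (k * l) := fun x ↦ finProdFinEquiv (X x, Y x)
  have hZ : Measurable Z := (measurable_of_countable finProdFinEquiv).comp (hX.prodMk hY)
  refine ⟨⟨k * l, Z, hZ⟩, ?_, ?_⟩
  · convert comap_cellMass_comp_le hZ fun j ↦ (finProdFinEquiv.symm j).1
    ext1 x
    simp only [Z, Function.comp_apply, Equiv.symm_apply_apply]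
  · convert comap_cellMass_comp_le hZ fun j ↦ (finProdFinEquiv.symm j).2
    ext1 x
    simp only [Z, Function.comp_apply, Equiv.symm_apply_apply]

/-- The partition into `A` and its complement already recovers the evaluation at `A`. -/
lemma iSup_comap_cellMass :
    ⨆ p : Σ k, {X : α → Fin k // Measurable X},
      MeasurableSpace.comap (cellMass p.2.1) inferInstance =
        (inferInstance : MeasurableSpace (Measure α)) := by
  classical
  refine le_antisymm (iSup_le fun p ↦ (measurable_cellMass p.2.2).comap_le) ?_
  refine iSup₂_le fun A hA ↦ ?_
  let X : α → Fin 2 := fun x ↦ if x ∈ A then 1 else 0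
  have hX : Measurable X := Measurable.ite hA measurable_const measurable_const
  refine le_trans ?_ (le_iSup _ ⟨2, X, hX⟩)
  have hXA : X ⁻¹' {1} = A := by
    ext x
    by_cases hx : x ∈ A <;> simp [X, hx]
  have hfac : (fun m : Measure α ↦ m A) = (fun v : Fin 2 → ℝ≥0∞ ↦ v 1) ∘ cellMass X := by
    ext m
    simp [cellMass, hXA]
  rw [hfac, ← MeasurableSpace.comap_comp, ← BorelSpace.measurable_eq (α := ℝ≥0∞)]
  exact MeasurableSpace.comap_mono (measurable_pi_apply 1).comap_le

lemma isProbabilityMeasure_processLaw (P : Measure Ω) [IsProbabilityMeasure P] (η : Kernel Ω α) :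
    IsProbabilityMeasure (processLaw P η) :=
  Measure.isProbabilityMeasure_map η.measurable.aemeasurable

namespace IsPoissonProcess

variable {P : Measure Ω} {η : Kernel Ω α}

lemma map_cellMass [IsProbabilityMeasure P] (h : IsPoissonProcess P η) {k : ℕ}
    {X : α → Fin k} (hX : Measurable X) :
    (processLaw P η).map (cellMass X) =
      Measure.pi fun i ↦ poissonLaw (expectationMeasure P η (X ⁻¹' {i})) := by
  have hmeas i : MeasurableSet (X ⁻¹' {i}) := hX (measurableSet_singleton i)
  rw [processLaw, Measure.map_map (measurable_cellMass hX) η.measurable]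
  have hind := h.indep k (fun i ↦ X ⁻¹' {i}) hmeas
    fun i j hij ↦ Disjoint.preimage X (by simpa using hij)
  rw [iIndepFun_iff_map_fun_eq_pi_map
    fun i ↦ (Kernel.measurable_coe η (hmeas i)).aemeasurable] at hind
  simp only [h.poisson _ (hmeas _)] at hind
  exact hind

/-- Supplies the countable support that `klDiv_le_infoDiv_of_countable` requires. -/
lemma map_cellMass_compl_eq_zero (h : IsPoissonProcess P η) {k : ℕ} {X : α → Fin k}
    (hX : Measurable X) :
    (processLaw P η).map (cellMass X) (univ.pi fun _ ↦ range ((↑) : ℕ∞ → ℝ≥0∞))ᶜ = 0 := by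
  have hS : MeasurableSet (univ.pi fun _ : Fin k ↦ range ((↑) : ℕ∞ → ℝ≥0∞)) :=
    (countable_univ_pi fun _ ↦ countable_range _).measurableSet
  rw [processLaw, Measure.map_map (measurable_cellMass hX) η.measurable,
    Measure.map_apply ((measurable_cellMass hX).comp η.measurable) hS.compl]
  convert measure_empty (μ := P)
  refine eq_empty_of_forall_notMem fun ω hω ↦ hω fun i _ ↦ ?_
  obtain ⟨n, hn⟩ := h.empirical ω _ (hX (measurableSet_singleton i))
  exact ⟨n, hn.symm⟩

end IsPoissonProcess

/-- The divergence of the laws of the cell masses of two Poisson processes. -/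
lemma klDiv_map_cellMass {Ω' : Type*} [MeasurableSpace Ω'] {P : Measure Ω} [IsProbabilityMeasure P]
    {Q : Measure Ω'} [IsProbabilityMeasure Q] {η : Kernel Ω α} {ξ : Kernel Ω' α}
    (hη : IsPoissonProcess P η) (hξ : IsPoissonProcess Q ξ)
    (hD : infoDiv (expectationMeasure P η) (expectationMeasure Q ξ) < ∞)
    {k : ℕ} {X : α → Fin k} (hX : Measurable X) :
    klDiv ((processLaw P η).map (cellMass X)) ((processLaw Q ξ).map (cellMass X)) =
      ∑ i, divTerm (expectationMeasure P η (X ⁻¹' {i})) (expectationMeasure Q ξ (X ⁻¹' {i})) := by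
  have hsum := (sum_divTerm_le_infoDiv (expectationMeasure P η) (expectationMeasure Q ξ) hX).trans_lt hD
  rw [hη.map_cellMass hX, hξ.map_cellMass hX, klDiv_pi]
  exact Finset.sum_congr rfl fun i hi ↦ klDiv_poissonLaw (ENNReal.sum_lt_top.1 hsum i hi).ne

end CellMasses

end ExpectationMeasure

/-! ### The divergence identity -/

open ExpectationMeasure in
theorem mainTheorem2 {α Ω Ω' : Type*} [MeasurableSpace α] [MeasurableSpace Ω] [MeasurableSpace Ω']
    (P : Measure Ω) [IsProbabilityMeasure P] (Q : Measure Ω') [IsProbabilityMeasure Q]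
    (η : Kernel Ω α) (ξ : Kernel Ω' α)
    (hη : ExpectationMeasure.IsPoissonProcess P η) (hξ : ExpectationMeasure.IsPoissonProcess Q ξ)
    (μ ν : Measure α)
    (hμ : μ = ExpectationMeasure.expectationMeasure P η)
    (hν : ν = ExpectationMeasure.expectationMeasure Q ξ)
    (hD : ExpectationMeasure.infoDiv μ ν < ∞) :
    ExpectationMeasure.infoDiv μ ν =
      ExpectationMeasure.infoDiv (ExpectationMeasure.processLaw P η)
        (ExpectationMeasure.processLaw Q ξ) := by
  subst hμ hν
  have := isProbabilityMeasure_processLaw P η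
  have := isProbabilityMeasure_processLaw Q ξ
  refine le_antisymm (infoDiv_le fun k X hX ↦ ?_) ?_
  · have hkl := klDiv_map_cellMass hη hξ hD hX
    have hne := ((sum_divTerm_le_infoDiv _ _ hX).trans_lt hD).ne
    rw [← hkl] at hne ⊢
    have hac := (klDiv_ne_top_iff.1 hne).1
    exact (klDiv_le_infoDiv_of_countable _ _ (countable_univ_pi fun _ ↦ countable_range _)
      (hξ.map_cellMass_compl_eq_zero hX) hac).trans (infoDiv_map_le _ _ (measurable_cellMass hX))
  · have : Nonempty (Σ k, {X : α → Fin k // Measurable X}) :=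
      ⟨1, fun _ ↦ 0, measurable_const⟩
    refine infoDiv_le_of_directed _ directed_comap_cellMass iSup_comap_cellMass _ _ ?_
    rintro ⟨l, X, hX⟩ k E hE hEd
    have hT := measurable_cellMass hX
    choose S hS hSE using hE
    -- Disjointness of the `E j` controls the `S j` only on the range of `cellMass X`. Removing the
    -- overlaps makes them disjoint everywhere without changing the preimages.
    let S' : Fin k → Set (Fin l → ℝ≥0∞) := fun j ↦ S j \ ⋃ i ∈ ({j}ᶜ : Set (Fin k)), S i
    have hS' j : MeasurableSet (S' j) :=
      (hS j).diff (MeasurableSet.biUnion (to_countable _) fun i _ ↦ hS i)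
    have hS'E j : cellMass X ⁻¹' S' j = E j := by
      simp only [S', preimage_sdiff, preimage_iUnion, hSE]
      have hdisj : Disjoint (E j) (⋃ i ∈ ({j}ᶜ : Set (Fin k)), E i) :=
        disjoint_iUnion₂_right.2 fun i hi ↦ hEd (Ne.symm hi)
      exact hdisj.sdiff_eq_left
    have hS'd : Pairwise fun i j ↦ Disjoint (S' i) (S' j) := fun i j hij ↦
      disjoint_left.2 fun x hxi hxj ↦ hxj.2 (mem_biUnion (x := i) hij hxi.1)
    calc ∑ j, divTerm (processLaw P η (E j)) (processLaw Q ξ (E j))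
    _ = ∑ j, divTerm ((processLaw P η).map (cellMass X) (S' j))
          ((processLaw Q ξ).map (cellMass X) (S' j)) := by
      simp only [Measure.map_apply hT (hS' _), hS'E]
    _ ≤ klDiv ((processLaw P η).map (cellMass X)) ((processLaw Q ξ).map (cellMass X)) :=
      sum_divTerm_le_klDiv _ _ hS' hS'd
    _ = _ := klDiv_map_cellMass hη hξ hD hX
    _ ≤ _ := sum_divTerm_le_infoDiv _ _ hX
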